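/- Let $p\ge 1$ and let $(X,d,\mu)$ be a compact Cheeger space of exponent $p$. That is, $(X,d)$ is a compact metric space, $\mu$ is a Radon measure on $X$ for which there is $C>0$ such that $$0<\mu(B(x,2r))\le C\,\mu(B(x,r))<\infty\qquad\text{for all }x\in X,\ r>0,$$ and there are $C>0$, $\lambda\ge 1$ such that for every Lipschitz function $f:X\to\mathbb R$ and every ball $B(x,R)$, $R>0$, $$\int_{B(x,R)}|f-f_{B(x,R)}|^p\,d\mu\le C R^p\int_{B(x,\lambda R)}(\mathrm{Lip} f)^p\,d\mu,$$ where $B(x,r)$ is the open ball, $f_{B}=\frac1{\mu(B)}\int_B f\,d\mu$ and $(\mathrm{Lip} f)(y)=\limsup_{r\to0^+}\sup_{d(x,y)\le r}\frac{|f(x)-f(y)|}{r}$. For $r>0$ and $f\in L^p(X,\mu)$ put $$E_{p,r}(f)=\frac1{r^p}\int_X\frac1{\mu(B(x,r))}\int_{B(x,r)}|f(y)-f(x)|^p\,d\mu(y)\,d\mu(x).$$ Let $(\varepsilon_n)$ be a sequence of positive numbers with $\varepsilon_n\to0$. Then every sequence $(f_n)$ in $L^p(X,\mu)$ (in particular,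 every sequence of functions $f_n\in L^p(X,\mu)$ with $\limsup_{r\to0^+}E_{p,r}(f_n)<\infty$ for each $n$) such that $$\liminf_{n\to\infty}\Big(E_{p,\varepsilon_n}(f_n)+\|f_n\|_{L^p(X,\mu)}^p\Big)<\infty$$ has a subsequence that converges strongly in $L^p(X,\mu)$. -/

import Mathlib

open Filter Topology MeasureTheory
open scoped NNReal ENNReal

/-- The pointwise (upper) Lipschitz constant
`(Lip f)(y) = limsup_{r → 0⁺} sup_{d(x,y) ≤ r} |f(x) - f(y)| / r`, with values in `[0, ∞]`. -/
noncomputable def pointwiseLip {X : Type*} [MetricSpace X] (f : X → ℝ) (y : X) : ℝ≥0∞ :=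
  limsup (fun r : ℝ => ⨆ x ∈ Metric.closedBall y r, ‖f x - f y‖ₑ / ENNReal.ofReal r) (𝓝[>] 0)

/-- `μ` is positive, finite on balls and doubling:
`0 < μ(B(x,2r)) ≤ C μ(B(x,r)) < ∞` for all `x` and all `r > 0`. -/
def IsPositiveDoubling {X : Type*} [MetricSpace X] [MeasurableSpace X] (μ : Measure X) : Prop :=
  ∃ C : ℝ≥0, ∀ (x : X) (r : ℝ), 0 < r →
    0 < μ (Metric.ball x (2 * r)) ∧
    μ (Metric.ball x (2 * r)) ≤ C * μ (Metric.ball x r) ∧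
    μ (Metric.ball x r) < ∞

/-- The `(p,p)`-Poincaré inequality for Lipschitz functions, with pointwise Lipschitz constants. -/
def HasPoincareInequality {X : Type*} [MetricSpace X] [MeasurableSpace X] (μ : Measure X)
    (p : ℝ) : Prop :=
  ∃ C lam : ℝ≥0, 1 ≤ lam ∧ ∀ f : X → ℝ, (∃ K : ℝ≥0, LipschitzWith K f) →
    ∀ (x : X) (R : ℝ), 0 < R →
      ∫⁻ y in Metric.ball x R, ‖f y - ⨍ z in Metric.ball x R, f z ∂μ‖ₑ ^ p ∂μ ≤
        C * ENNReal.ofReal R ^ p *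
          ∫⁻ y in Metric.ball x (lam * R), pointwiseLip f y ^ p ∂μ

/-- A Cheeger space (PI space) of exponent `p`: a complete, locally compact metric space with a
Radon measure that is positive and doubling and supports a `(p,p)`-Poincaré inequality. -/
structure IsCheegerSpace {X : Type*} [MetricSpace X] [MeasurableSpace X] (μ : Measure X)
    (p : ℝ) : Prop where
  complete : CompleteSpace X
  locallyCompact : LocallyCompactSpace X
  radon : μ.Regular
  doubling : IsPositiveDoubling μ
  poincare : HasPoincareInequality μ p

/-- The Korevaar-Schoen energy
`E_{p,r}(f) = r^{-p} ∫_X ⨍_{B(x,r)} |f(y) - f(x)|^p dμ(y) dμ(x)`, with values in `[0, ∞]`. -/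
noncomputable def korevaarSchoenEnergy {X : Type*} [MetricSpace X] [MeasurableSpace X]
    (μ : Measure X) (p r : ℝ) (f : X → ℝ) : ℝ≥0∞ :=
  (∫⁻ x, (⨍⁻ y in Metric.ball x r, ‖f y - f x‖ₑ ^ p ∂μ) ∂μ) / ENNReal.ofReal r ^ p

/-! Each $f_n$ is mollified at its own scale $\varepsilon=\varepsilon_n$: $F_n(x)$ is the mean of
$f_n$ weighted by a tent centred at $x$. Doubling makes the mass of the tent comparable to
$\mu(B(x,\varepsilon))$, so both $|F_n-f_n|(x)$ and $\varepsilon\,\mathrm{Lip}F_n(x)$ are at most a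
constant times the average of $|f_n-f_n(x)|$ over $B(x,\varepsilon)$. With Jensen,
$\|F_n-f_n\|_p^p\lesssim\varepsilon^pE_{p,\varepsilon}(f_n)$ and $\int(\mathrm{Lip}F_n)^p\lesssim
E_{p,\varepsilon}(f_n)$ (`lintegral_tentMean_sub_self_le`, `lintegral_pointwiseLip_tentMean_le`).

It remains to show that the $F_n$ are precompact (`totallyBounded_range_toLp`). On a finite net of
balls of radius comparable to $R$ with bounded overlap, the Poincaré inequality puts every $F_n$
within $O(R)$ in $L^p$ of a function constant on finitely many cells. These functions form a bounded
set in a finite-dimensional space. Letting $R\to0$ gives total boundedness, and completeness of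
$L^p$ a limit, which the $f_n$ share along the subsequence. -/

section Doubling

variable {X : Type*} [MetricSpace X] [MeasurableSpace X] {μ : Measure X}

/-- A normalised form of the doubling condition, with a real constant at least one. -/
structure DoublingWith (μ : Measure X) (C : ℝ) : Prop where
  one_le : 1 ≤ C
  pos : ∀ (x : X) (r : ℝ), 0 < r → 0 < μ.real (Metric.ball x r)
  le : ∀ (x : X) (r : ℝ), 0 < r →
    μ.real (Metric.ball x (2 * r)) ≤ C * μ.real (Metric.ball x r)

theorem IsPositiveDoubling.exists_doublingWith [IsFiniteMeasure μ] (h : IsPositiveDoubling μ) :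
    ∃ C, DoublingWith μ C := by
  obtain ⟨C, hC⟩ := h
  refine ⟨max C 1, le_max_right _ _, fun x r hr => ?_, fun x r hr => ?_⟩
  · have := (hC x (r / 2) (by linarith)).1
    rw [mul_div_cancel₀ _ two_ne_zero] at this
    exact ENNReal.toReal_pos this.ne' (measure_ne_top _ _)
  · have h1 := ENNReal.toReal_mono
      (ENNReal.mul_ne_top ENNReal.coe_ne_top (measure_ne_top _ _)) (hC x r hr).2.1
    rw [ENNReal.toReal_mul, ENNReal.coe_toReal] at h1
    exact h1.trans (mul_le_mul_of_nonneg_right (le_max_left _ _) measureReal_nonneg)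

theorem DoublingWith.measureReal_ball_pow_le {C : ℝ} (h : DoublingWith μ C) (k : ℕ) (x : X)
    {r : ℝ} (hr : 0 < r) :
    μ.real (Metric.ball x (2 ^ k * r)) ≤ C ^ k * μ.real (Metric.ball x r) := by
  induction k with
  | zero => simp
  | succ k ih =>
    have h1 := h.le x (2 ^ k * r) (by positivity)
    calc μ.real (Metric.ball x (2 ^ (k + 1) * r))
        = μ.real (Metric.ball x (2 * (2 ^ k * r))) := by rw [pow_succ]; ring_nf
      _ ≤ C * (C ^ k * μ.real (Metric.ball x r)) :=
        h1.trans (mul_le_mul_of_nonneg_left ih (zero_le_one.trans h.one_le))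
      _ = _ := by ring

theorem DoublingWith.measureReal_le_of_subset [IsFiniteMeasure μ] {C : ℝ} (h : DoublingWith μ C)
    (k : ℕ) {s : Set X} {x : X} {r : ℝ} (hr : 0 < r) (hs : s ⊆ Metric.ball x (2 ^ k * r)) :
    μ.real s ≤ C ^ k * μ.real (Metric.ball x r) :=
  (measureReal_mono hs).trans (h.measureReal_ball_pow_le k x hr)

/-- The dilates of separated balls have bounded overlap in a doubling space. -/
theorem DoublingWith.card_le_of_pairwise_disjoint_ball [OpensMeasurableSpace X]
    [IsFiniteMeasure μ] {C : ℝ} (h : DoublingWith μ C) (k : ℕ) {r t : ℝ} (hr : 0 < r)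
    (ht : r + 2 * t ≤ 2 ^ k * r) (s : Finset X)
    (hs : (s : Set X).PairwiseDisjoint fun x => Metric.ball x r) (y : X)
    (hy : ∀ x ∈ s, y ∈ Metric.ball x t) : (s.card : ℝ) ≤ C ^ k := by
  rcases s.eq_empty_or_nonempty with rfl | ⟨x₀, hx₀⟩
  · simpa using pow_nonneg (zero_le_one.trans h.one_le) k
  have htpos : 0 < t := dist_nonneg.trans_lt (hy x₀ hx₀)
  set m := μ.real (Metric.ball y (r + t)) with hm
  have hmpos : 0 < m := h.pos _ _ (by linarith)
  have hsub : ∀ x ∈ s, Metric.ball y (r + t) ⊆ Metric.ball x (2 ^ k * r) := fun x hx =>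
    Metric.ball_subset_ball' (by linarith [Metric.mem_ball.1 (hy x hx)])
  have h1 : ∑ x ∈ s, μ.real (Metric.ball x r) ≤ m := by
    rw [← measureReal_biUnion_finset hs fun _ _ => Metric.isOpen_ball.measurableSet]
    refine measureReal_mono (Set.iUnion₂_subset fun x hx => Metric.ball_subset_ball' ?_)
    linarith [Metric.mem_ball'.1 (hy x hx)]
  have h2 : s.card * m ≤ C ^ k * m := by
    calc s.card * m = ∑ x ∈ s, m := by simp
      _ ≤ ∑ x ∈ s, C ^ k * μ.real (Metric.ball x r) :=
        Finset.sum_le_sum fun x hx => h.measureReal_le_of_subset k hr (hsub x hx)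
      _ = C ^ k * ∑ x ∈ s, μ.real (Metric.ball x r) := by rw [Finset.mul_sum]
      _ ≤ C ^ k * m :=
        mul_le_mul_of_nonneg_left h1 (pow_nonneg (zero_le_one.trans h.one_le) k)
  exact le_of_mul_le_mul_right h2 hmpos

end Doubling

/-! ### Overlap counting, measurable selections and finite nets -/

/-- A family of measurable sets of multiplicity at most `N` has total integral at most `N` times
the integral over the whole space, with no measurability of the integrand required. -/
theorem sum_setLIntegral_le_of_card_le {α : Type*} [MeasurableSpace α] {μ : Measure α}
    {ι : Type*} (s : Finset ι) (B : ι → Set α) (hB : ∀ i, MeasurableSet (B i))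
    (N : ℝ≥0) (hN : ∀ y, ∀ u ⊆ s, (∀ i ∈ u, y ∈ B i) → (u.card : ℝ) ≤ N) (h : α → ℝ≥0∞) :
    ∑ i ∈ s, ∫⁻ x in B i, h x ∂μ ≤ N * ∫⁻ x, h x ∂μ := by
  classical
  -- The inequality is proved between measures and only then integrated, so the integrand, later a
  -- power of `pointwiseLip`, may be non-measurable.
  rw [← lintegral_finsetSum_measure, ← smul_eq_mul, ← lintegral_smul_measure]
  refine lintegral_mono' (Measure.le_iff.2 fun E hE => ?_) le_rfl
  have h1 : (∑ i ∈ s, μ.restrict (B i)) E = ∫⁻ y in E, ∑ i ∈ s, (B i).indicator 1 y ∂μ := by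
    rw [lintegral_finsetSum _ fun i _ => measurable_one.indicator (hB i)]
    simp only [Measure.coe_finsetSum, Finset.sum_apply]
    refine Finset.sum_congr rfl fun i _ => ?_
    rw [lintegral_indicator_one (hB i), Measure.restrict_apply hE,
      Measure.restrict_apply (hB i), Set.inter_comm]
  rw [h1]
  calc ∫⁻ y in E, ∑ i ∈ s, (B i).indicator 1 y ∂μ ≤ ∫⁻ y in E, (N : ℝ≥0∞) ∂μ := by
        refine lintegral_mono fun y => ?_
        have h2 : ∑ i ∈ s, (B i).indicator (1 : α → ℝ≥0∞) y =
            ((s.filter fun i => y ∈ B i).card : ℝ≥0∞) := by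
          simp [Set.indicator_apply]
        have h3 := hN y (s.filter fun i => y ∈ B i) (Finset.filter_subset _ _) (by simp)
        rw [h2]
        have h4 : ((s.filter fun i => y ∈ B i).card : ℝ≥0) ≤ N := by exact_mod_cast h3
        rw [← ENNReal.coe_natCast]
        exact ENNReal.coe_le_coe.2 h4
    _ = _ := by
      rw [setLIntegral_const, Measure.smul_apply, smul_eq_mul]

/-- A measurable selection from a finite measurable cover. -/
theorem exists_measurable_index_of_cover {α ι : Type*} [MeasurableSpace α] [Finite ι]
    [MeasurableSpace ι] (B : ι → Set α) (hB : ∀ i, MeasurableSet (B i))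
    (hcov : ∀ x, ∃ i, x ∈ B i) : ∃ j : α → ι, Measurable j ∧ ∀ x, x ∈ B (j x) := by
  classical
  rcases isEmpty_or_nonempty α with hα | ⟨⟨x₀⟩⟩
  · exact ⟨isEmptyElim, measurable_of_empty _, isEmptyElim⟩
  obtain ⟨i₀, -⟩ := hcov x₀
  obtain ⟨n, ⟨e⟩⟩ := Finite.exists_equiv_fin ι
  -- `j x` is the first index whose set contains `x`. The filler `i₀` is never reached, since some
  -- index below `n` already works.
  let g : ℕ → ι := fun k => if hk : k < n then e.symm ⟨k, hk⟩ else i₀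
  have hg : ∀ i, g (e i) = i := fun i => by simp [g]
  have hp : ∀ x, ∃ k, x ∈ B (g k) := fun x => by
    obtain ⟨i, hi⟩ := hcov x
    exact ⟨e i, by rwa [hg]⟩
  exact ⟨fun x => g (Nat.find (hp x)),
    (measurable_from_top (f := g)).comp (measurable_find hp fun k => hB _),
    fun x => Nat.find_spec (hp x)⟩

/-- A compact metric space has finite separated nets at every scale. -/
theorem exists_finite_separated_net (X : Type*) [MetricSpace X] [CompactSpace X] {r : ℝ}
    (hr : 0 < r) : ∃ s : Finset X, (s : Set X).PairwiseDisjoint (fun x => Metric.ball x (r / 2)) ∧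
      ∀ y, ∃ x ∈ s, y ∈ Metric.ball x (2 * r) := by
  lift r to ℝ≥0 using hr.le
  have hr' : r ≠ 0 := by exact_mod_cast hr.ne'
  -- A maximal `r`-separated set is the net; it is finite because packing at scale `r` is bounded by
  -- covering at scale `r / 2`.
  have hfin : Metric.packingNumber r (Set.univ : Set X) ≠ ⊤ := by
    have h2 : (r / 2 : ℝ≥0) ≠ 0 := by positivity
    obtain ⟨N, -, hNf, hN⟩ := Metric.exists_finite_isCover_of_isCompact h2 (isCompact_univ (X := X))
    have h3 := Metric.packingNumber_two_mul_le_externalCoveringNumber (r / 2) (Set.univ : Set X)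
    rw [mul_div_cancel₀ _ two_ne_zero] at h3
    exact ((h3.trans hN.externalCoveringNumber_le_encard).trans_lt
      (by simpa using hNf)).ne
  have hf : (Metric.maximalSeparatedSet r (Set.univ : Set X)).Finite := by
    rwa [← Set.encard_ne_top_iff, Metric.encard_maximalSeparatedSet hfin]
  have hsep := Metric.isSeparated_maximalSeparatedSet (ε := r) (A := (Set.univ : Set X))
  refine ⟨hf.toFinset, ?_, fun y => ?_⟩
  · intro x hx y hy hxy
    have hlt : (r : ℝ≥0∞) < edist x y := hsep (by simpa using hx) (by simpa using hy) hxy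
    rw [edist_nndist] at hlt
    have : (r : ℝ) < dist x y := by exact_mod_cast hlt
    exact Metric.ball_disjoint_ball (by linarith)
  · obtain ⟨x, hx, hxy⟩ := Metric.isCover_maximalSeparatedSet hfin (Set.mem_univ y)
    refine ⟨x, by simpa using hx, ?_⟩
    have hxy' : edist y x ≤ r := hxy
    rw [edist_nndist] at hxy'
    have : dist y x ≤ r := by exact_mod_cast hxy'
    exact Metric.mem_ball.2 (by linarith)

/-! ### Mollification by tent-weighted means -/

section Tent

variable {X : Type*} [MetricSpace X]

/-- The tent function of height one and radius `ε / 2` centred at `x`. -/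
noncomputable def tent (ε : ℝ) (x y : X) : ℝ := max 0 (1 - 2 / ε * dist x y)

theorem tent_nonneg (ε : ℝ) (x y : X) : 0 ≤ tent ε x y := le_max_left _ _

theorem tent_le_one {ε : ℝ} (hε : 0 < ε) (x y : X) : tent ε x y ≤ 1 := by
  have : 0 ≤ 2 / ε * dist x y := by positivity
  exact max_le zero_le_one (by linarith)

theorem tent_eq_zero {ε : ℝ} (hε : 0 < ε) {x y : X} (h : ε / 2 ≤ dist x y) : tent ε x y = 0 := by
  refine max_eq_left ?_
  have : 2 / ε * (ε / 2) ≤ 2 / ε * dist x y := by gcongr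
  have h1 : 2 / ε * (ε / 2) = 1 := by field_simp
  linarith

theorem half_le_tent {ε : ℝ} (hε : 0 < ε) {x y : X} (h : dist x y ≤ ε / 4) :
    1 / 2 ≤ tent ε x y := by
  refine le_trans ?_ (le_max_right _ _)
  have : 2 / ε * dist x y ≤ 2 / ε * (ε / 4) := by gcongr
  have h1 : 2 / ε * (ε / 4) = 1 / 2 := by field_simp; norm_num
  linarith

theorem abs_tent_sub_le {ε : ℝ} (hε : 0 < ε) (x x' y : X) :
    |tent ε x y - tent ε x' y| ≤ 2 / ε * dist x x' := by
  unfold tent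
  refine (abs_max_sub_max_le_max _ _ _ _).trans ?_
  have h1 : |1 - 2 / ε * dist x y - (1 - 2 / ε * dist x' y)| =
      2 / ε * |dist x y - dist x' y| := by
    rw [← abs_of_pos (show 0 < 2 / ε by positivity), ← abs_mul, abs_sub_comm,
      abs_of_pos (show 0 < 2 / ε by positivity)]
    ring_nf
  rw [h1, sub_self, abs_zero]
  refine max_le (by positivity) ?_
  gcongr
  exact abs_dist_sub_le _ _ _

theorem continuous_tent (ε : ℝ) (x : X) : Continuous (tent ε x) := by
  unfold tent
  fun_prop

variable [MeasurableSpace X] {μ : Measure X}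

theorem abs_setIntegral_tent_mul_le {ε : ℝ} (hε : 0 < ε) {g : X → ℝ} (hg : Integrable g μ)
    (S : Set X) (x : X) : |∫ y in S, tent ε x y * g y ∂μ| ≤ ∫ y in S, |g y| ∂μ := by
  rw [← Real.norm_eq_abs]
  refine norm_integral_le_of_norm_le hg.abs.restrict (ae_of_all _ fun y => ?_)
  rw [norm_mul, Real.norm_of_nonneg (tent_nonneg ε x y), Real.norm_eq_abs]
  exact mul_le_of_le_one_left (abs_nonneg _) (tent_le_one hε x y)

variable [BorelSpace X]

theorem integrable_tent (μ : Measure X) [IsFiniteMeasure μ] {ε : ℝ} (hε : 0 < ε) (x : X) :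
    Integrable (tent ε x) μ :=
  .of_bound (continuous_tent ε x).aestronglyMeasurable 1 <| ae_of_all _ fun y => by
    rw [Real.norm_of_nonneg (tent_nonneg ε x y)]
    exact tent_le_one hε x y

theorem integrable_tent_mul {ε : ℝ} (hε : 0 < ε) (x : X)
    {g : X → ℝ} (hg : Integrable g μ) : Integrable (fun y => tent ε x y * g y) μ :=
  hg.bdd_mul (continuous_tent ε x).aestronglyMeasurable (c := 1) <| ae_of_all _ fun y => by
    rw [Real.norm_of_nonneg (tent_nonneg ε x y)]
    exact tent_le_one hε x y

/-- The average of `f` around `x` weighted by the tent function. -/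
noncomputable def tentMean (μ : Measure X) (ε : ℝ) (f : X → ℝ) (x : X) : ℝ :=
  (∫ y, tent ε x y * f y ∂μ) / ∫ y, tent ε x y ∂μ

theorem abs_setIntegral_tent_mul_sub_le {ε : ℝ} (hε : 0 < ε) {g : X → ℝ} (hg : Integrable g μ)
    (S : Set X) (x x' : X) :
    |(∫ y in S, tent ε x y * g y ∂μ) - ∫ y in S, tent ε x' y * g y ∂μ| ≤
      2 / ε * dist x x' * ∫ y in S, |g y| ∂μ := by
  rw [← integral_sub (integrable_tent_mul hε x hg).restrict
    (integrable_tent_mul hε x' hg).restrict, ← integral_const_mul, ← Real.norm_eq_abs]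
  refine norm_integral_le_of_norm_le (hg.abs.restrict.const_mul _) (ae_of_all _ fun y => ?_)
  rw [← sub_mul, norm_mul, Real.norm_eq_abs, Real.norm_eq_abs]
  gcongr
  exact abs_tent_sub_le hε x x' y

variable [IsFiniteMeasure μ]

theorem tentMean_sub {ε : ℝ} (hε : 0 < ε) {f : X → ℝ} (hf : Integrable f μ) (c : ℝ) {x : X}
    (hx : 0 < ∫ y, tent ε x y ∂μ) :
    tentMean μ ε f x - c = (∫ y, tent ε x y * (f y - c) ∂μ) / ∫ y, tent ε x y ∂μ := by
  have h : ∫ y, tent ε x y * (f y - c) ∂μ =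
      (∫ y, tent ε x y * f y ∂μ) - (∫ y, tent ε x y ∂μ) * c := by
    simp only [mul_sub]
    rw [integral_sub (integrable_tent_mul hε x hf) ((integrable_tent μ hε x).mul_const c),
      integral_mul_const]
  rw [h, tentMean]
  field_simp

/-- The weight is at most one, lives in `S`, and has total mass at least `μ.real S / A`; the mean is
thus dominated by `A` times the plain average over `S`. -/
theorem abs_tentMean_sub_const_le {ε : ℝ} (hε : 0 < ε) {f : X → ℝ} (hf : Integrable f μ)
    {S : Set X} {A : ℝ} {x : X} (hxS : ∀ y, y ∉ S → tent ε x y = 0) (hS : 0 < μ.real S)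
    (hx : μ.real S ≤ A * ∫ y, tent ε x y ∂μ) (c : ℝ) :
    |tentMean μ ε f x - c| ≤ A * ⨍ y in S, |f y - c| ∂μ := by
  have hw0 : 0 ≤ ∫ y, tent ε x y ∂μ := integral_nonneg (tent_nonneg ε x)
  have hw : 0 < ∫ y, tent ε x y ∂μ := by
    refine hw0.lt_of_ne fun h => ?_
    rw [← h, mul_zero] at hx
    linarith
  rw [tentMean_sub hε hf c hw, setAverage_eq, smul_eq_mul, abs_div, abs_of_pos hw,
    div_le_iff₀ hw, ← setIntegral_eq_integral_of_forall_compl_eq_zero (s := S)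
      (f := fun y => tent ε x y * (f y - c)) fun y hy => by rw [hxS y hy, zero_mul]]
  refine (abs_setIntegral_tent_mul_le hε (hf.sub (integrable_const c)) S x).trans ?_
  set J := ∫ y in S, |f y - c| ∂μ
  have hJ : 0 ≤ J := integral_nonneg fun _ => abs_nonneg _
  calc J = (μ.real S)⁻¹ * J * μ.real S := by field_simp
    _ ≤ (μ.real S)⁻¹ * J * (A * ∫ y, tent ε x y ∂μ) := by gcongr
    _ = _ := by ring

/-- A quotient rule: numerator and mass both vary with slope `2 / ε` in the centre, giving the terms
`A` and `A ^ 2` respectively. Constants pass through the mean, so `c` is free. -/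
theorem abs_tentMean_sub_tentMean_le {ε : ℝ} (hε : 0 < ε) {f : X → ℝ} (hf : Integrable f μ)
    {S : Set X} {A : ℝ} {x x' : X} (hxS : ∀ y, y ∉ S → tent ε x y = 0)
    (hxS' : ∀ y, y ∉ S → tent ε x' y = 0) (hS : 0 < μ.real S)
    (hx : μ.real S ≤ A * ∫ y, tent ε x y ∂μ) (hx' : μ.real S ≤ A * ∫ y, tent ε x' y ∂μ) (c : ℝ) :
    |tentMean μ ε f x - tentMean μ ε f x'| ≤
      2 / ε * (A + A ^ 2) * (⨍ y in S, |f y - c| ∂μ) * dist x x' := by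
  have hpos : ∀ z, μ.real S ≤ A * ∫ y, tent ε z y ∂μ → 0 < ∫ y, tent ε z y ∂μ := fun z hz => by
    refine (integral_nonneg (tent_nonneg ε z)).lt_of_ne fun h => ?_
    rw [← h, mul_zero] at hz
    linarith
  have hw := hpos x hx
  have hw' := hpos x' hx'
  have hA : 0 < A := pos_of_mul_pos_left (hS.trans_le hx) hw.le
  have hg : Integrable (fun y => f y - c) μ := hf.sub (integrable_const c)
  have hI := abs_setIntegral_tent_mul_sub_le hε hg S x x'
  have hI' := abs_setIntegral_tent_mul_le hε hg S x'
  -- The case `g = 1` controls the variation of the mass.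
  have hW := abs_setIntegral_tent_mul_sub_le hε (integrable_const (μ := μ) (1 : ℝ)) S x x'
  simp only [mul_one, abs_one, integral_const, smul_eq_mul, measureReal_restrict_apply_univ] at hW
  have e : tentMean μ ε f x - tentMean μ ε f x' =
      (tentMean μ ε f x - c) - (tentMean μ ε f x' - c) := by ring
  have hz : ∀ z, (∀ y, y ∉ S → tent ε z y = 0) → ∫ y, tent ε z y ∂μ = ∫ y in S, tent ε z y ∂μ :=
    fun z h => (setIntegral_eq_integral_of_forall_compl_eq_zero h).symm
  have hzg : ∀ z, (∀ y, y ∉ S → tent ε z y = 0) → ∫ y, tent ε z y * (f y - c) ∂μ =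
      ∫ y in S, tent ε z y * (f y - c) ∂μ :=
    fun z h => (setIntegral_eq_integral_of_forall_compl_eq_zero
      fun y hy => by rw [h y hy, zero_mul]).symm
  rw [e, tentMean_sub hε hf c hw, tentMean_sub hε hf c hw', setAverage_eq, smul_eq_mul,
    hzg x hxS, hzg x' hxS']
  rw [hz x hxS] at hw hx ⊢
  rw [hz x' hxS'] at hw' hx' ⊢
  set I := ∫ y in S, tent ε x y * (f y - c) ∂μ
  set I' := ∫ y in S, tent ε x' y * (f y - c) ∂μ
  set w := ∫ y in S, tent ε x y ∂μ
  set w' := ∫ y in S, tent ε x' y ∂μ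
  set J := ∫ y in S, |f y - c| ∂μ
  set m := μ.real S
  set d := 2 / ε * dist x x' with hd
  have hd0 : 0 ≤ d := by positivity
  have hJ : 0 ≤ J := (abs_nonneg _).trans hI'
  have key : I / w - I' / w' = (I - I') / w + I' * (w' - w) / (w * w') := by
    field_simp
    ring
  have hiw : 1 / w ≤ A / m := by rw [div_le_div_iff₀ hw hS]; linarith
  have hiw' : 1 / w' ≤ A / m := by rw [div_le_div_iff₀ hw' hS]; linarith
  calc |I / w - I' / w'| ≤ |I - I'| * (1 / w) + |I'| * |w - w'| * ((1 / w) * (1 / w')) := by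
        rw [key]
        refine (abs_add_le _ _).trans (le_of_eq ?_)
        rw [abs_div, abs_div, abs_mul, abs_mul, abs_of_pos hw, abs_of_pos hw', abs_sub_comm w' w]
        field_simp
    _ ≤ d * J * (A / m) + J * (d * m) * ((A / m) * (A / m)) := by gcongr
    _ = 2 / ε * (A + A ^ 2) * (m⁻¹ * J) * dist x x' := by
        rw [hd]
        field_simp

/-- The tent is at least `1 / 2` on the ball of radius `ε / 4`, and `k + 2` doublings lead from
there to radius `2 ^ k * ε`. -/
theorem DoublingWith.measureReal_le_mul_integral_tent {C : ℝ} (h : DoublingWith μ C) {ε : ℝ}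
    (hε : 0 < ε) (k : ℕ) {S : Set X} {x : X} (hS : S ⊆ Metric.ball x (2 ^ k * ε)) :
    μ.real S ≤ 2 * C ^ (k + 2) * ∫ y, tent ε x y ∂μ := by
  have h1 : μ.real S ≤ C ^ (k + 2) * μ.real (Metric.ball x (ε / 4)) := by
    refine h.measureReal_le_of_subset (k + 2) (by positivity) ?_
    convert hS using 2
    rw [pow_add]
    ring
  have h2 : 1 / 2 * μ.real (Metric.ball x (ε / 4)) ≤ ∫ y, tent ε x y ∂μ := by
    calc 1 / 2 * μ.real (Metric.ball x (ε / 4)) = ∫ y in Metric.ball x (ε / 4), 1 / 2 ∂μ := by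
          simp [mul_comm]
      _ ≤ ∫ y in Metric.ball x (ε / 4), tent ε x y ∂μ :=
        setIntegral_mono_on (integrable_const _) (integrable_tent μ hε x).integrableOn
          Metric.isOpen_ball.measurableSet fun y hy =>
            half_le_tent hε (Metric.mem_ball'.1 hy).le
      _ ≤ _ := setIntegral_le_integral (integrable_tent μ hε x) (ae_of_all _ (tent_nonneg ε x))
  have hC : 0 ≤ C ^ (k + 2) := pow_nonneg (zero_le_one.trans h.one_le) _
  nlinarith

/-- Here `S` is the whole space, swallowed by one large ball. The constant is not uniform in `ε`;
the result only serves to make the Poincaré inequality applicable. -/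
theorem DoublingWith.exists_lipschitzWith_tentMean [CompactSpace X] {C : ℝ} (h : DoublingWith μ C) {ε : ℝ}
    (hε : 0 < ε) {f : X → ℝ} (hf : Integrable f μ) :
    ∃ K : ℝ≥0, LipschitzWith K (tentMean μ ε f) := by
  obtain ⟨k, hk⟩ := pow_unbounded_of_one_lt (Metric.diam (Set.univ : Set X) / ε) one_lt_two
  rw [div_lt_iff₀ hε] at hk
  have hsub : ∀ x : X, Set.univ ⊆ Metric.ball x (2 ^ k * ε) := fun x y _ =>
    (Metric.dist_le_diam_of_mem isCompact_univ.isBounded (Set.mem_univ y)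
      (Set.mem_univ x)).trans_lt hk
  refine ⟨_, LipschitzWith.of_dist_le' (K := 2 / ε * (2 * C ^ (k + 2) + (2 * C ^ (k + 2)) ^ 2) *
    ⨍ y in Set.univ, |f y - 0| ∂μ) fun x x' => ?_⟩
  refine abs_tentMean_sub_tentMean_le hε hf (by simp) (by simp) ?_
    (h.measureReal_le_mul_integral_tent hε k (hsub x))
    (h.measureReal_le_mul_integral_tent hε k (hsub x')) 0
  exact (h.pos x ε hε).trans_le (measureReal_mono (Set.subset_univ _))

theorem DoublingWith.abs_tentMean_sub_self_le {C : ℝ} (h : DoublingWith μ C) {ε : ℝ}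
    (hε : 0 < ε) {f : X → ℝ} (hf : Integrable f μ) (x : X) :
    |tentMean μ ε f x - f x| ≤ 2 * C ^ 2 * ⨍ y in Metric.ball x ε, |f y - f x| ∂μ := by
  refine abs_tentMean_sub_const_le hε hf (fun y hy => tent_eq_zero hε ?_) (h.pos x ε hε)
    (h.measureReal_le_mul_integral_tent hε 0 (by simp)) _
  rw [Metric.mem_ball', not_lt] at hy
  linarith

/-- Tents have radius `ε / 2`, so for centres this close both supports lie in the ball of radius `ε`
around `x`, the one appearing in the energy. -/
theorem DoublingWith.abs_tentMean_sub_tentMean_le_of_dist_le {C : ℝ} (h : DoublingWith μ C)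
    {ε : ℝ} (hε : 0 < ε) {f : X → ℝ} (hf : Integrable f μ) {x x' : X} (hx : dist x x' ≤ ε / 2) :
    |tentMean μ ε f x - tentMean μ ε f x'| ≤ 2 / ε * (2 * C ^ 3 + (2 * C ^ 3) ^ 2) *
      (⨍ y in Metric.ball x ε, |f y - f x| ∂μ) * dist x x' := by
  refine abs_tentMean_sub_tentMean_le hε hf (fun y hy => tent_eq_zero hε ?_)
    (fun y hy => tent_eq_zero hε ?_) (h.pos x ε hε)
    (h.measureReal_le_mul_integral_tent hε 1 (Metric.ball_subset_ball (by linarith)))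
    (h.measureReal_le_mul_integral_tent hε 1 (Metric.ball_subset_ball' (by linarith))) _
  all_goals rw [Metric.mem_ball', not_lt] at hy
  · linarith
  · linarith [dist_triangle x x' y]

end Tent

/-! ### Bounds by the Korevaar-Schoen energy -/

section Energy

/-- Jensen's inequality for powers of lower integrals. -/
theorem setLAverage_rpow_le {α : Type*} [MeasurableSpace α] {μ : Measure α} {p : ℝ}
    (hp : 1 ≤ p) {s : Set α} (hs₀ : μ s ≠ 0) (hs : μ s ≠ ∞) {h : α → ℝ}
    (hh : AEStronglyMeasurable h μ) :
    (⨍⁻ y in s, ‖h y‖ₑ ∂μ) ^ p ≤ ⨍⁻ y in s, ‖h y‖ₑ ^ p ∂μ := by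
  have hp0 : 0 < p := zero_lt_one.trans_le hp
  -- For the normalised restriction, this is monotonicity of `eLpNorm` in the exponent.
  have : IsProbabilityMeasure ((μ.restrict s Set.univ)⁻¹ • μ.restrict s) := ⟨by
    rw [Measure.smul_apply, smul_eq_mul, Measure.restrict_apply_univ]
    exact ENNReal.inv_mul_cancel hs₀ hs⟩
  have hp1 : (1 : ℝ≥0∞) ≤ ENNReal.ofReal p := by simpa using hp
  have h1 := eLpNorm_le_eLpNorm_of_exponent_le hp1
    ((hh.restrict (s := s)).smul_measure (μ.restrict s Set.univ)⁻¹)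
  rw [eLpNorm_one_eq_lintegral_enorm, eLpNorm_eq_lintegral_rpow_enorm_toReal (by simpa using hp0)
    ENNReal.ofReal_ne_top, ENNReal.toReal_ofReal hp0.le] at h1
  have h2 := ENNReal.rpow_le_rpow h1 hp0.le
  rwa [← ENNReal.rpow_mul, one_div_mul_cancel hp0.ne', ENNReal.rpow_one] at h2

theorem eLpNorm_ofReal_rpow {α : Type*} [MeasurableSpace α] {μ : Measure α} {p : ℝ}
    (hp : 1 ≤ p) (u : α → ℝ) :
    eLpNorm u (ENNReal.ofReal p) μ ^ p = ∫⁻ x, ‖u x‖ₑ ^ p ∂μ := by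
  have hp0 : 0 < p := zero_lt_one.trans_le hp
  rw [eLpNorm_eq_lintegral_rpow_enorm_toReal (by simpa using hp0)
    ENNReal.ofReal_ne_top, ENNReal.toReal_ofReal hp0.le, ← ENNReal.rpow_mul,
    one_div_mul_cancel hp0.ne', ENNReal.rpow_one]

variable {X : Type*} [MetricSpace X]

theorem pointwiseLip_le_of_local_bound {F : X → ℝ} {x : X} {L δ : ℝ} (hδ : 0 < δ) (hL : 0 ≤ L)
    (h : ∀ y, dist y x ≤ δ → |F y - F x| ≤ L * dist y x) :
    pointwiseLip F x ≤ ENNReal.ofReal L := by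
  refine limsup_le_of_le ?_ ?_
  · isBoundedDefault
  filter_upwards [Ioc_mem_nhdsGT hδ] with r hr
  refine iSup₂_le fun y hy => ?_
  rw [Metric.mem_closedBall] at hy
  refine ENNReal.div_le_of_le_mul ?_
  rw [← ENNReal.ofReal_mul hL, ← ofReal_norm, Real.norm_eq_abs]
  exact ENNReal.ofReal_le_ofReal
    ((h y (hy.trans hr.2)).trans (mul_le_mul_of_nonneg_left hy hL))

variable [MeasurableSpace X] {μ : Measure X}

theorem lintegral_setLAverage_eq_korevaarSchoenEnergy (μ : Measure X) {p ε : ℝ} (hε : 0 < ε)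
    (f : X → ℝ) : ∫⁻ x, (⨍⁻ y in Metric.ball x ε, ‖f y - f x‖ₑ ^ p ∂μ) ∂μ =
      korevaarSchoenEnergy μ p ε f * ENNReal.ofReal ε ^ p := by
  have h0 : ENNReal.ofReal ε ≠ 0 := by simpa using hε
  refine (ENNReal.div_mul_cancel ?_ ?_).symm
  · exact (ENNReal.rpow_pos (by simpa using hε) ENNReal.ofReal_ne_top).ne'
  · exact ENNReal.rpow_ne_top_of_ne_zero h0 ENNReal.ofReal_ne_top

theorem DoublingWith.ofReal_mul_setAverage_rpow_le [IsFiniteMeasure μ] {C : ℝ} (h : DoublingWith μ C) {p : ℝ}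
    (hp : 1 ≤ p) {ε : ℝ} (hε : 0 < ε) {f : X → ℝ} (hf : Integrable f μ) (x : X) {L : ℝ}
    (hL : 0 ≤ L) :
    ENNReal.ofReal (L * ⨍ y in Metric.ball x ε, |f y - f x| ∂μ) ^ p ≤
      ENNReal.ofReal L ^ p * ⨍⁻ y in Metric.ball x ε, ‖f y - f x‖ₑ ^ p ∂μ := by
  have hp0 : 0 ≤ p := zero_le_one.trans hp
  have hg : Integrable (fun y => f y - f x) μ := hf.sub (integrable_const _)
  rw [ENNReal.ofReal_mul hL, ENNReal.mul_rpow_of_nonneg _ _ hp0]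
  gcongr
  have hpos : μ (Metric.ball x ε) ≠ 0 := fun h0 => by
    have := h.pos x ε hε
    simp [Measure.real, h0] at this
  refine le_trans ?_ (setLAverage_rpow_le hp hpos (measure_ne_top _ _) hg.aestronglyMeasurable)
  gcongr
  rw [ofReal_setAverage hg.abs.integrableOn (ae_of_all _ fun y => abs_nonneg _), setLAverage_eq]
  simp only [← Real.norm_eq_abs, ofReal_norm]
  exact le_rfl

variable [BorelSpace X] [IsFiniteMeasure μ]

theorem DoublingWith.lintegral_tentMean_sub_self_le {C : ℝ} (h : DoublingWith μ C) {p : ℝ}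
    (hp : 1 ≤ p) {ε : ℝ} (hε : 0 < ε) {f : X → ℝ} (hf : Integrable f μ) :
    ∫⁻ x, ‖tentMean μ ε f x - f x‖ₑ ^ p ∂μ ≤
      ENNReal.ofReal (2 * C ^ 2) ^ p * (korevaarSchoenEnergy μ p ε f * ENNReal.ofReal ε ^ p) := by
  have hp0 : 0 ≤ p := zero_le_one.trans hp
  rw [← lintegral_setLAverage_eq_korevaarSchoenEnergy μ hε, ← lintegral_const_mul' _ _
    (ENNReal.rpow_ne_top_of_nonneg hp0 ENNReal.ofReal_ne_top)]
  refine lintegral_mono fun x => ?_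
  refine le_trans ?_ (h.ofReal_mul_setAverage_rpow_le hp hε hf x (by positivity))
  gcongr
  rw [← ofReal_norm]
  exact ENNReal.ofReal_le_ofReal (h.abs_tentMean_sub_self_le hε hf x)

/-- The slope `1 / ε` of the tent cancels the factor `ε ^ p` carried by the integral of the
averages, which leaves a bound uniform in `ε`. -/
theorem DoublingWith.lintegral_pointwiseLip_tentMean_le {C : ℝ} (h : DoublingWith μ C) {p : ℝ}
    (hp : 1 ≤ p) {ε : ℝ} (hε : 0 < ε) {f : X → ℝ} (hf : Integrable f μ) :
    ∫⁻ x, pointwiseLip (tentMean μ ε f) x ^ p ∂μ ≤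
      ENNReal.ofReal (2 * (2 * C ^ 3 + (2 * C ^ 3) ^ 2)) ^ p * korevaarSchoenEnergy μ p ε f := by
  have hp0 : 0 ≤ p := zero_le_one.trans hp
  have hC : 0 ≤ C := zero_le_one.trans h.one_le
  set D := 2 * (2 * C ^ 3 + (2 * C ^ 3) ^ 2)
  have hD : 0 ≤ D := by positivity
  have h1 : ∫⁻ x, pointwiseLip (tentMean μ ε f) x ^ p ∂μ ≤
      ENNReal.ofReal (D / ε) ^ p *
        ∫⁻ x, (⨍⁻ y in Metric.ball x ε, ‖f y - f x‖ₑ ^ p ∂μ) ∂μ := by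
    rw [← lintegral_const_mul' _ _ (ENNReal.rpow_ne_top_of_nonneg hp0 ENNReal.ofReal_ne_top)]
    refine lintegral_mono fun x => ?_
    refine le_trans ?_ (h.ofReal_mul_setAverage_rpow_le hp hε hf x (by positivity))
    gcongr
    have hav : 0 ≤ ⨍ y in Metric.ball x ε, |f y - f x| ∂μ :=
      integral_nonneg fun _ => abs_nonneg _
    refine pointwiseLip_le_of_local_bound (half_pos hε) (by positivity) fun y hy => ?_
    rw [dist_comm] at hy
    rw [abs_sub_comm, dist_comm]
    refine (h.abs_tentMean_sub_tentMean_le_of_dist_le hε hf hy).trans (le_of_eq ?_)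
    simp only [D]
    ring
  refine h1.trans (le_of_eq ?_)
  rw [lintegral_setLAverage_eq_korevaarSchoenEnergy μ hε, mul_comm (korevaarSchoenEnergy _ _ _ _),
    ← mul_assoc, ← ENNReal.mul_rpow_of_nonneg _ _ hp0, ← ENNReal.ofReal_mul (by positivity),
    div_mul_cancel₀ _ hε.ne']

end Energy

/-! ### Rellich-type compactness -/

section Rellich

theorem totallyBounded_of_forall_exists_dist_lt {α : Type*} [PseudoMetricSpace α] {s : Set α}
    (h : ∀ δ > 0, ∃ T : Set α, TotallyBounded T ∧ ∀ x ∈ s, ∃ y ∈ T, dist x y < δ) :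
    TotallyBounded s := by
  refine Metric.totallyBounded_iff.2 fun δ hδ => ?_
  obtain ⟨T, hT, hsT⟩ := h (δ / 2) (half_pos hδ)
  obtain ⟨t, ht, hTt⟩ := Metric.totallyBounded_iff.1 hT (δ / 2) (half_pos hδ)
  refine ⟨t, ht, fun x hx => ?_⟩
  obtain ⟨y, hy, hxy⟩ := hsT x hx
  obtain ⟨z, hz, hyz⟩ := Set.mem_iUnion₂.1 (hTt hy)
  exact Set.mem_iUnion₂.2 ⟨z, hz, Metric.mem_ball.2
    ((dist_triangle x y z).trans_lt (by linarith [Metric.mem_ball.1 hyz]))⟩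

theorem lintegral_comp_index_le_sum {α ι : Type*} [MeasurableSpace α] {μ : Measure α} [Fintype ι]
    {B : ι → Set α} (hB : ∀ i, MeasurableSet (B i)) {j : α → ι} (hj : ∀ x, x ∈ B (j x))
    {g : ι → α → ℝ≥0∞} (hg : ∀ i, Measurable (g i)) :
    ∫⁻ x, g (j x) x ∂μ ≤ ∑ i, ∫⁻ x in B i, g i x ∂μ := by
  calc ∫⁻ x, g (j x) x ∂μ ≤ ∫⁻ x, ∑ i, (B i).indicator (g i) x ∂μ := by
        refine lintegral_mono fun x => ?_
        refine le_trans (le_of_eq ?_) (Finset.single_le_sum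
          (f := fun i => (B i).indicator (g i) x) (fun _ _ => zero_le) (Finset.mem_univ (j x)))
        exact (Set.indicator_of_mem (hj x) _).symm
    _ = _ := by
        rw [lintegral_finsetSum _ fun i _ => (hg i).indicator (hB i)]
        exact Finset.sum_congr rfl fun i _ => lintegral_indicator (hB i) _

variable {X : Type*} [MetricSpace X] [CompactSpace X] [MeasurableSpace X] [BorelSpace X]
  {μ : Measure X} [IsFiniteMeasure μ]

/-- At every scale `R`, Lipschitz functions are approximated by their averages over a finite
family of balls, with an error controlled by `R` times the `p`-energy. -/
theorem DoublingWith.exists_finite_averages_approx {C : ℝ} (h : DoublingWith μ C) {p : ℝ}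
    (hp : 1 ≤ p) (hP : HasPoincareInequality μ p) :
    ∃ D : ℝ≥0∞, D ≠ ∞ ∧ ∀ R : ℝ, 0 < R → ∃ (s : Finset X) (j : X → s), Measurable j ∧
      ∀ F : X → ℝ, (∃ K : ℝ≥0, LipschitzWith K F) →
        ∫⁻ x, ‖F x - ⨍ z in Metric.ball (j x : X) (2 * R), F z ∂μ‖ₑ ^ p ∂μ ≤
          D * ENNReal.ofReal R ^ p * ∫⁻ x, pointwiseLip F x ^ p ∂μ := by
  classical
  have hp0 : 0 ≤ p := zero_le_one.trans hp
  obtain ⟨C', lam, hlam, hP⟩ := hP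
  -- The overlap bound is used with disjoint balls of radius `R / 2` and dilates of radius `2 * lam
  -- * R`; its condition becomes `1 + 8 * lam ≤ 2 ^ k`.
  obtain ⟨k, hk⟩ := pow_unbounded_of_one_lt (1 + 8 * (lam : ℝ)) one_lt_two
  have hCk : 0 ≤ C ^ k := pow_nonneg (zero_le_one.trans h.one_le) k
  refine ⟨C' * ENNReal.ofReal 2 ^ p * (C ^ k).toNNReal, ?_, fun R hR => ?_⟩
  · exact ENNReal.mul_ne_top (ENNReal.mul_ne_top ENNReal.coe_ne_top
      (ENNReal.rpow_ne_top_of_nonneg hp0 ENNReal.ofReal_ne_top)) ENNReal.coe_ne_top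
  obtain ⟨s, hdisj, hcov⟩ := exists_finite_separated_net X hR
  obtain ⟨j, hjm, hj⟩ := exists_measurable_index_of_cover
    (fun i : s => Metric.ball (i : X) (2 * R)) (fun _ => Metric.isOpen_ball.measurableSet)
    (fun x => by
      obtain ⟨i, hi, hx⟩ := hcov x
      exact ⟨⟨i, hi⟩, hx⟩)
  refine ⟨s, j, hjm, fun F hF => ?_⟩
  have hFm : Measurable F := by
    obtain ⟨K, hK⟩ := hF
    exact hK.continuous.measurable
  refine (lintegral_comp_index_le_sum (fun _ => Metric.isOpen_ball.measurableSet) hj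
    (g := fun i x => ‖F x - ⨍ z in Metric.ball (i : X) (2 * R), F z ∂μ‖ₑ ^ p)
    fun i => ((hFm.sub_const _).enorm.pow_const p)).trans ?_
  have hover := sum_setLIntegral_le_of_card_le (μ := μ) s
    (fun i => Metric.ball i (lam * (2 * R))) (fun _ => Metric.isOpen_ball.measurableSet)
    (C ^ k).toNNReal (fun y u hu hy => by
      rw [Real.coe_toNNReal _ hCk]
      refine h.card_le_of_pairwise_disjoint_ball k (half_pos hR) ?_ u
        (hdisj.subset (by exact_mod_cast hu)) y hy
      nlinarith) (fun x => pointwiseLip F x ^ p)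
  calc ∑ i : s, ∫⁻ x in Metric.ball (i : X) (2 * R),
        ‖F x - ⨍ z in Metric.ball (i : X) (2 * R), F z ∂μ‖ₑ ^ p ∂μ
      ≤ ∑ i : s, C' * ENNReal.ofReal (2 * R) ^ p *
          ∫⁻ x in Metric.ball (i : X) (lam * (2 * R)), pointwiseLip F x ^ p ∂μ :=
        Finset.sum_le_sum fun i _ => hP F hF i (2 * R) (by linarith)
    _ = C' * ENNReal.ofReal (2 * R) ^ p * ∑ i ∈ s,
          ∫⁻ x in Metric.ball i (lam * (2 * R)), pointwiseLip F x ^ p ∂μ := by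
        rw [← Finset.mul_sum]
        congr 1
        exact Finset.sum_coe_sort s
          fun i => ∫⁻ x in Metric.ball i (lam * (2 * R)), pointwiseLip F x ^ p ∂μ
    _ ≤ C' * ENNReal.ofReal (2 * R) ^ p *
          ((C ^ k).toNNReal * ∫⁻ x, pointwiseLip F x ^ p ∂μ) := by gcongr
    _ = _ := by
        rw [ENNReal.ofReal_mul zero_le_two, ENNReal.mul_rpow_of_nonneg _ _ hp0]
        ring

theorem memLp_comp_of_finite {α ι : Type*} [MeasurableSpace α] [Finite ι] [MeasurableSpace ι]
    [MeasurableSingletonClass ι] (μ : Measure α) [IsFiniteMeasure μ] (q : ℝ≥0∞) {j : α → ι}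
    (hj : Measurable j) (a : ι → ℝ) : MemLp (fun x => a (j x)) q μ := by
  have := Fintype.ofFinite ι
  exact .of_bound ((measurable_of_finite a).comp hj).aestronglyMeasurable ‖a‖
    (ae_of_all _ fun x => norm_le_pi_norm a (j x))

/-- Functions constant on the cells of a finite measurable partition, as a linear map into
`Lᵖ`. -/
noncomputable def cellwiseConstLp {α ι : Type*} [MeasurableSpace α] [Finite ι] [MeasurableSpace ι]
    [MeasurableSingletonClass ι] (μ : Measure α) [IsFiniteMeasure μ] (q : ℝ≥0∞) {j : α → ι}
    (hj : Measurable j) : (ι → ℝ) →ₗ[ℝ] Lp ℝ q μ where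
  toFun a := MemLp.toLp (fun x => a (j x)) (memLp_comp_of_finite μ q hj a)
  map_add' _ _ := rfl
  map_smul' _ _ := rfl

theorem edist_toLp_cellwiseConstLp {α ι : Type*} [MeasurableSpace α] [Finite ι] [MeasurableSpace ι]
    [MeasurableSingletonClass ι] {μ : Measure α} [IsFiniteMeasure μ] {q : ℝ≥0∞} {j : α → ι}
    (hj : Measurable j) (a : ι → ℝ) {g : α → ℝ} (hg : MemLp g q μ) :
    edist (hg.toLp g) (cellwiseConstLp μ q hj a) = eLpNorm (g - fun x => a (j x)) q μ :=
  Lp.edist_toLp_toLp g _ hg (memLp_comp_of_finite μ q hj a)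

/-- A Rellich-type theorem: Lipschitz functions with bounded `Lᵖ` norm and bounded `p`-energy form
a totally bounded set in `Lᵖ`. -/
theorem DoublingWith.totallyBounded_range_toLp {C : ℝ} (h : DoublingWith μ C) {p : ℝ}
    (hp : 1 ≤ p) [Fact (1 ≤ ENNReal.ofReal p)] (hP : HasPoincareInequality μ p)
    {κ : Type*} {F : κ → X → ℝ} (hF : ∀ k, ∃ K : ℝ≥0, LipschitzWith K (F k))
    (hFp : ∀ k, MemLp (F k) (ENNReal.ofReal p) μ) {M M' : ℝ≥0∞} (hM : M ≠ ∞) (hM' : M' ≠ ∞)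
    (hLip : ∀ k, ∫⁻ x, pointwiseLip (F k) x ^ p ∂μ ≤ M)
    (hnorm : ∀ k, eLpNorm (F k) (ENNReal.ofReal p) μ ≤ M') :
    TotallyBounded (Set.range fun k => (hFp k).toLp (F k)) := by
  have hp0 : 0 < p := zero_lt_one.trans_le hp
  have hp1 : (1 : ℝ≥0∞) ≤ ENNReal.ofReal p := Fact.out
  obtain ⟨D, hD, hDR⟩ := h.exists_finite_averages_approx hp hP
  refine totallyBounded_of_forall_exists_dist_lt fun δ hδ => ?_
  obtain ⟨R, hR, hRδ⟩ : ∃ R : ℝ, 0 < R ∧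
      D * ENNReal.ofReal R ^ p * M < ENNReal.ofReal δ ^ p := by
    have ht : Tendsto (fun R : ℝ => D * M * ENNReal.ofReal R ^ p) (𝓝[>] 0) (𝓝 0) := by
      have h1 : Tendsto (fun R : ℝ => ENNReal.ofReal R ^ p) (𝓝[>] 0) (𝓝 (ENNReal.ofReal 0 ^ p)) :=
        ((ENNReal.continuous_rpow_const.comp ENNReal.continuous_ofReal).tendsto 0).mono_left
          nhdsWithin_le_nhds
      have h2 := ENNReal.Tendsto.const_mul h1 (Or.inr (ENNReal.mul_ne_top hD hM))
      simpa [ENNReal.zero_rpow_of_pos hp0] using h2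
    have hpos : 0 < ENNReal.ofReal δ ^ p :=
      ENNReal.rpow_pos (by simpa using hδ) ENNReal.ofReal_ne_top
    obtain ⟨R, hR, hR0⟩ := ((ht.eventually_lt_const hpos).and self_mem_nhdsWithin).exists
    refine ⟨R, hR0, lt_of_eq_of_lt ?_ hR⟩
    ring
  obtain ⟨s, j, hjm, hj⟩ := hDR R hR
  -- On a finite measure space the `Lᵖ` bound gives an `L¹` bound uniform in `k`, and hence bounded
  -- ball averages.
  obtain ⟨A₁, hA₁⟩ : ∃ A₁ : ℝ, ∀ k, ∫ x, |F k x| ∂μ ≤ A₁ := by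
    set q := M' * μ Set.univ ^ (1 / (1 : ℝ≥0∞).toReal - 1 / (ENNReal.ofReal p).toReal) with hq
    have hqt : q ≠ ∞ := by
      refine ENNReal.mul_ne_top hM' (ENNReal.rpow_ne_top_of_nonneg ?_ (measure_ne_top _ _))
      rw [ENNReal.toReal_one, ENNReal.toReal_ofReal hp0.le, div_one, sub_nonneg, div_le_one hp0]
      exact hp
    refine ⟨q.toReal, fun k => ?_⟩
    have h1 := eLpNorm_le_eLpNorm_mul_rpow_measure_univ hp1 (hFp k).aestronglyMeasurable
    rw [eLpNorm_one_eq_lintegral_enorm] at h1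
    have h2 : ∫⁻ x, ‖F k x‖ₑ ∂μ ≤ q := h1.trans (mul_le_mul_left (hnorm k) _)
    calc ∫ x, |F k x| ∂μ = (∫⁻ x, ‖F k x‖ₑ ∂μ).toReal :=
          integral_norm_eq_lintegral_enorm (hFp k).aestronglyMeasurable
      _ ≤ q.toReal := ENNReal.toReal_mono hqt h2
  -- A crude bound, the sum dominating each average; only uniformity in `k` matters.
  let A : ℝ := ∑ i : s, (μ.real (Metric.ball (i : X) (2 * R)))⁻¹ * |A₁|
  have hAnonneg : ∀ i : s, 0 ≤ (μ.real (Metric.ball (i : X) (2 * R)))⁻¹ * |A₁| := fun i => by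
    positivity
  let L := cellwiseConstLp μ (ENNReal.ofReal p) hjm
  refine ⟨L '' Metric.closedBall 0 A, ((isCompact_closedBall 0 A).image
    L.continuous_of_finiteDimensional).totallyBounded, ?_⟩
  rintro _ ⟨k, rfl⟩
  refine ⟨_, ⟨fun i => ⨍ z in Metric.ball (i : X) (2 * R), F k z ∂μ, ?_, rfl⟩, ?_⟩
  · rw [mem_closedBall_zero_iff, pi_norm_le_iff_of_nonneg (Finset.sum_nonneg fun i _ => hAnonneg i)]
    intro i
    refine le_trans ?_ (Finset.single_le_sum (fun i _ => hAnonneg i) (Finset.mem_univ i))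
    rw [setAverage_eq, norm_smul, norm_inv, Real.norm_of_nonneg measureReal_nonneg]
    gcongr
    refine (norm_integral_le_integral_norm _).trans (le_trans ?_ ((hA₁ k).trans (le_abs_self _)))
    exact setIntegral_le_integral ((hFp k).integrable hp1).norm (ae_of_all _ fun _ => norm_nonneg _)
  · rw [dist_comm, dist_edist]
    refine (ENNReal.toReal_lt_of_lt_ofReal ?_)
    rw [edist_comm]
    rw [edist_toLp_cellwiseConstLp hjm _ (hFp k)]
    rw [← ENNReal.rpow_lt_rpow_iff hp0, eLpNorm_ofReal_rpow hp]
    exact ((hj (F k) (hF k)).trans (mul_le_mul_right (hLip k) _)).trans_lt hRδ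

end Rellich

/-! ### The compactness theorem -/

theorem theoremT {X : Type*} [MetricSpace X] [CompactSpace X] [MeasurableSpace X] [BorelSpace X]
    (μ : Measure X) (p : ℝ) (hp : 1 ≤ p) (hX : IsCheegerSpace μ p)
    (ε : ℕ → ℝ) (hε_pos : ∀ n, 0 < ε n) (hε : Tendsto ε atTop (𝓝 0))
    (f : ℕ → X → ℝ) (hf : ∀ n, MemLp (f n) (ENNReal.ofReal p) μ)
    (hbound : liminf (fun n => korevaarSchoenEnergy μ p (ε n) (f n) +
      eLpNorm (f n) (ENNReal.ofReal p) μ ^ p) atTop < ∞) :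
    ∃ φ : ℕ → ℕ, StrictMono φ ∧ ∃ g : X → ℝ, MemLp g (ENNReal.ofReal p) μ ∧
      Tendsto (fun k => eLpNorm (f (φ k) - g) (ENNReal.ofReal p) μ) atTop (𝓝 0) := by
  have hp0 : 0 < p := zero_lt_one.trans_le hp
  have hp1 : (1 : ℝ≥0∞) ≤ ENNReal.ofReal p := by simpa using hp
  have : Fact (1 ≤ ENNReal.ofReal p) := ⟨hp1⟩
  -- Regularity makes `μ` finite on compact sets, hence finite on `X`.
  have := hX.radon
  obtain ⟨C, hC⟩ := hX.doubling.exists_doublingWith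
  obtain ⟨M, hM, hMtop⟩ := exists_between hbound
  -- Besides the energy bound, the subsequence has `ε (φ k) ≤ 1`, so that the mollification error
  -- has a bound independent of `k`.
  obtain ⟨φ, hφ, hφM⟩ := extraction_of_frequently_atTop
    ((frequently_lt_of_liminf_lt (by isBoundedDefault) hM).and_eventually
      (hε.eventually_le_const zero_lt_one))
  have hE : ∀ k, korevaarSchoenEnergy μ p (ε (φ k)) (f (φ k)) ≤ M := fun k =>
    le_self_add.trans (hφM k).1.le
  have hN : ∀ k, eLpNorm (f (φ k)) (ENNReal.ofReal p) μ ^ p ≤ M := fun k =>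
    le_add_self.trans (hφM k).1.le
  have hint : ∀ k, Integrable (f (φ k)) μ := fun k => (hf _).integrable hp1
  let F : ℕ → X → ℝ := fun k => tentMean μ (ε (φ k)) (f (φ k))
  have hF : ∀ k, ∃ K : ℝ≥0, LipschitzWith K (F k) := fun k =>
    hC.exists_lipschitzWith_tentMean (hε_pos _) (hint k)
  have hFm : ∀ k, AEStronglyMeasurable (F k) μ := fun k => by
    obtain ⟨K, hK⟩ := hF k
    exact hK.continuous.aestronglyMeasurable
  set c : ℝ≥0∞ := ENNReal.ofReal (2 * C ^ 2) ^ p * M with hc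
  have hctop : c ≠ ∞ := ENNReal.mul_ne_top
    (ENNReal.rpow_ne_top_of_nonneg hp0.le ENNReal.ofReal_ne_top) hMtop.ne
  have hdiff : ∀ k, eLpNorm (F k - f (φ k)) (ENNReal.ofReal p) μ ^ p ≤
      c * ENNReal.ofReal (ε (φ k)) ^ p := fun k => by
    rw [eLpNorm_ofReal_rpow hp, hc, mul_assoc]
    refine (hC.lintegral_tentMean_sub_self_le hp (hε_pos _) (hint k)).trans ?_
    gcongr
    exact hE k
  have hdiff0 : Tendsto (fun k => eLpNorm (F k - f (φ k)) (ENNReal.ofReal p) μ) atTop (𝓝 0) := by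
    have h1 : Tendsto (fun k => ENNReal.ofReal (ε (φ k)) ^ p) atTop (𝓝 (ENNReal.ofReal 0 ^ p)) :=
      ((ENNReal.continuous_rpow_const.comp ENNReal.continuous_ofReal).tendsto 0).comp
        (hε.comp hφ.tendsto_atTop)
    have h2 : Tendsto (fun k => c * ENNReal.ofReal (ε (φ k)) ^ p) atTop (𝓝 0) := by
      simpa [ENNReal.zero_rpow_of_pos hp0] using ENNReal.Tendsto.const_mul h1 (Or.inr hctop)
    -- The `p`-th powers of the norms tend to zero; continuity of the `p`-th root transfers this to
    -- the norms.
    have h3 := (ENNReal.continuous_rpow_const (y := p⁻¹)).tendsto 0 |>.comp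
      (tendsto_of_tendsto_of_tendsto_of_le_of_le tendsto_const_nhds h2 (fun _ => zero_le) hdiff)
    rw [ENNReal.zero_rpow_of_pos (inv_pos.2 hp0)] at h3
    refine h3.congr fun k => ?_
    rw [Function.comp_apply, ← ENNReal.rpow_mul, mul_inv_cancel₀ hp0.ne', ENNReal.rpow_one]
  have hroot : ∀ {a b : ℝ≥0∞}, a ^ p ≤ b → a ≤ b ^ p⁻¹ := fun h =>
    (ENNReal.le_rpow_inv_iff hp0).2 h
  have hnorm : ∀ k, eLpNorm (F k) (ENNReal.ofReal p) μ ≤ c ^ p⁻¹ + M ^ p⁻¹ := fun k => by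
    have e : F k = (F k - f (φ k)) + f (φ k) := (sub_add_cancel _ _).symm
    rw [e]
    refine (eLpNorm_add_le ((hFm k).sub (hf _).aestronglyMeasurable)
      (hf _).aestronglyMeasurable hp1).trans
      (add_le_add (hroot ((hdiff k).trans (mul_le_of_le_one_right' ?_))) (hroot (hN k)))
    exact ENNReal.rpow_le_one (by simpa using (hφM k).2) hp0.le
  have hnormtop : c ^ p⁻¹ + M ^ p⁻¹ ≠ ∞ := ENNReal.add_ne_top.2
    ⟨ENNReal.rpow_ne_top_of_nonneg (inv_nonneg.2 hp0.le) hctop,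
      ENNReal.rpow_ne_top_of_nonneg (inv_nonneg.2 hp0.le) hMtop.ne⟩
  have hFp : ∀ k, MemLp (F k) (ENNReal.ofReal p) μ := fun k =>
    ⟨hFm k, (hnorm k).trans_lt hnormtop.lt_top⟩
  have htb := hC.totallyBounded_range_toLp hp hX.poincare hF hFp
    (M := ENNReal.ofReal (2 * (2 * C ^ 3 + (2 * C ^ 3) ^ 2)) ^ p * M)
    (ENNReal.mul_ne_top (ENNReal.rpow_ne_top_of_nonneg hp0.le ENNReal.ofReal_ne_top) hMtop.ne)
    hnormtop (fun k => (hC.lintegral_pointwiseLip_tentMean_le hp (hε_pos _) (hint k)).trans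
      (mul_le_mul_right (hE k) _)) hnorm
  obtain ⟨G, -, ψ, hψ, hG⟩ := (htb.closure.isCompact_of_isClosed
    isClosed_closure).tendsto_subseq fun k => subset_closure (Set.mem_range_self k)
  refine ⟨φ ∘ ψ, hφ.comp hψ, G, Lp.memLp G, ?_⟩
  have hG' : Tendsto (fun k => eLpNorm (F (ψ k) - (G : X → ℝ)) (ENNReal.ofReal p) μ) atTop (𝓝 0) := by
    refine (Lp.tendsto_Lp_iff_tendsto_eLpNorm'' (fun k => F (ψ k)) (fun k => hFp (ψ k)) (G : X → ℝ)
      (Lp.memLp G)).1 ?_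
    rw [Lp.toLp_coeFn]
    exact hG
  have hsum := (hdiff0.comp hψ.tendsto_atTop).add hG'
  rw [add_zero] at hsum
  refine tendsto_of_tendsto_of_tendsto_of_le_of_le tendsto_const_nhds hsum (fun _ => zero_le)
    fun k => ?_
  have e : f (φ (ψ k)) - (G : X → ℝ) = (f (φ (ψ k)) - F (ψ k)) + (F (ψ k) - (G : X → ℝ)) := by abel
  simp only [Function.comp_apply]
  rw [e, eLpNorm_sub_comm (F (ψ k)) (f (φ (ψ k)))]
  exact eLpNorm_add_le ((hf _).aestronglyMeasurable.sub (hFm _))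
    ((hFm _).sub (Lp.memLp G).aestronglyMeasurable) hp1
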